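/- Let $p$ be a prime with $p\equiv 1\pmod 4$ and let $\mathfrak p$ be a prime of $\mathbb Z[i]$ lying above $p$; identify $\mathbb Z[i]/\mathfrak p$ with $\mathbb F_p$. Let $\phi$ be the quadratic character of $\mathbb F_p^\times$, and let $\psi_{\mathfrak p}$ be the multiplicative character of order $4$ of $(\mathbb Z[i]/\mathfrak p)^\times\simeq\mathbb F_p^\times$ with values in $\mathbb Z[i]\subset\mathbb C$ satisfying $\psi_{\mathfrak p}(x)\equiv x^{(p-1)/4}\pmod{\mathfrak p}$ for every $x\in\mathbb Z[i]$. All multiplicative characters of $\mathbb F_p^\times$, including the trivial character $\varepsilon$, are extended to $\mathbb F_p$ by the value $0$ at $0$. For multiplicative characters $A,B,C$ of $\mathbb F_p^\times$ and $x\in\mathbb F_p$ put $$ {}_2F_1\left(\begin{matrix}A & B\\ & C\end{matrix};x\right)=\varepsilon(x)\,\frac{BC(-1)}{p}\sum_{y\in\mathbb F_p}B(y)\,C\overline B(1-y)\,\overline A(1-xy). $$ Let $\chi$ be the Hecke character of $\mathbb Q(i)$ associated to the elliptic curve $E\colon y^2=x^3-x$ over $\mathbb Q$, that is, $L(E,s)=L(\chi,s)$,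 normalized so that $\chi(\mathfrak P)\in\mathfrak P$ for all primes $\mathfrak P$ of $\mathbb Z[i]$ (where $\chi$ takes the value $0$ at ideals not coprime to its modulus). Let $a\in\mathbb F_p$ with $a\neq 0,1$. 1. If at least one of $a$ and $1-a$ is not a square in $\mathbb F_p^\times$, then $$ {}_2F_1\left(\begin{matrix}\overline{\psi_{\mathfrak p}} & \psi_{\mathfrak p}\\ & \phi\end{matrix};a\right)=0. $$ 2. If both $a$ and $1-a$ are squares in $\mathbb F_p^\times$, then for every $b\in\mathbb F_p^\times$ with $a=b^2$, $$ {}_2F_1\left(\begin{matrix}\overline{\psi_{\mathfrak p}} & \psi_{\mathfrak p}\\ & \phi\end{matrix};a\right)=-\frac{2}{p}\,\phi(1+b)\,\chi(\mathfrak p). $$ -/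

import Mathlib

/-- The quadratic character `φ` of `𝔽_p`, with values in `ℂ`. -/
noncomputable def quadChar (p : ℕ) [Fact p.Prime] : MulChar (ZMod p) ℂ :=
  (quadraticChar (ZMod p)).ringHomComp (Int.castRingHom ℂ)

/-- The finite field hypergeometric function
`₂F₁(A, B; C; x) = ε(x) · (BC(-1)/q) · ∑_y B(y) · C B̄(1 - y) · Ā(1 - x y)`
over the finite field `F` with `q` elements. All multiplicative characters, including the trivial
character `ε`, vanish at `0`, and the inverse of a character is its complex conjugate. -/
noncomputable def hypergeom2F1 {F : Type*} [Field F] [Fintype F] (A B C : MulChar F ℂ) (x : F) :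
    ℂ :=
  (1 : MulChar F ℂ) x * ((B * C) (-1) / (Fintype.card F : ℂ)) *
    ∑ y : F, B y * (C * B⁻¹) (1 - y) * A⁻¹ (1 - x * y)

/-- `ψ` is the quartic character of `𝔽_p` attached to the prime `𝔭` of `ℤ[i]` above `p`: it has
order `4`, and `ψ(x) ≡ x ^ ((p - 1) / 4) mod 𝔭` for all `x ∈ ℤ[i]`. Here `ψ(x)` is the value of `ψ`
at the class of `x` under the canonical identification `ℤ[i]/𝔭 = 𝔽_p`, that is, at the class
modulo `p` of any rational integer `n` congruent to `x` modulo `𝔭`. -/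
def IsQuarticCharacterAt (p : ℕ) (𝔭 : Ideal GaussianInt) (ψ : MulChar (ZMod p) ℂ) : Prop :=
  orderOf ψ = 4 ∧
    ∀ (x : GaussianInt) (n : ℤ), x - (n : GaussianInt) ∈ 𝔭 →
      ∃ z : GaussianInt, GaussianInt.toComplex z = ψ (n : ZMod p) ∧ z - x ^ ((p - 1) / 4) ∈ 𝔭

/-- A Hecke character (Größencharakter) of `ℚ(i)`, as a multiplicative function on the ideals of
`ℤ[i]`. For some modulus `𝔪 ≠ 0` there are a character `ε` of `(ℤ[i]/𝔪)ˣ` and a continuous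
character `χ∞` of `(ℚ(i) ⊗ ℝ)ˣ = ℂˣ` such that `χ((α)) = ε(α) χ∞(α)` for all nonzero `α` coprime
to `𝔪`; as usual, `χ` is extended by `0` to the ideals that are not coprime to `𝔪`.
(All ideals of `ℤ[i]` are principal.) -/
structure GaussianHeckeCharacter where
  toHom : Ideal GaussianInt →*₀ ℂ
  exists_modulus : ∃ (𝔪 : Ideal GaussianInt) (ε : (GaussianInt ⧸ 𝔪)ˣ →* ℂˣ) (χinf : ℂˣ →* ℂˣ),
    𝔪 ≠ ⊥ ∧ Continuous χinf ∧
    (∀ (α : GaussianInt) (u : (GaussianInt ⧸ 𝔪)ˣ) (v : ℂˣ),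
      (u : GaussianInt ⧸ 𝔪) = Ideal.Quotient.mk 𝔪 α → (v : ℂ) = GaussianInt.toComplex α →
        toHom (Ideal.span {α}) = (ε u : ℂ) * (χinf v : ℂ)) ∧
    (∀ α : GaussianInt, ¬ IsUnit (Ideal.Quotient.mk 𝔪 α) → toHom (Ideal.span {α}) = 0)

/-- The `L`-function `L(χ, s) = ∑_𝔞 χ(𝔞) N(𝔞)⁻ˢ` of a Hecke character, as a formal Dirichlet
series: its `n`-th coefficient is the sum of `χ(𝔞)` over the ideals `𝔞` of norm `n`. -/
noncomputable def GaussianHeckeCharacter.LFunction (χ : GaussianHeckeCharacter) :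
    ArithmeticFunction ℂ where
  toFun n := if n = 0 then 0 else
    ∑ᶠ (𝔞 : Ideal GaussianInt) (_ : Nat.card (GaussianInt ⧸ 𝔞) = n), χ.toHom 𝔞
  map_zero' := if_pos rfl

/-- The elliptic curve `y² = x³ - x` over `ℚ`. -/
def curveE : WeierstrassCurve ℚ := ⟨0, 0, 0, -1, 0⟩

/-- `χ` is associated to the elliptic curve `E` over `ℚ`: `L(E, s) = L(χ, s)`. -/
def GaussianHeckeCharacter.IsAssociatedTo (χ : GaussianHeckeCharacter) (E : WeierstrassCurve ℚ) :
    Prop :=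
  (E.LFunction : ArithmeticFunction ℂ) = χ.LFunction

/-- The normalization `χ(𝔓) ∈ 𝔓` for all (nonzero) primes `𝔓` of `ℤ[i]`. -/
def GaussianHeckeCharacter.IsNormalized (χ : GaussianHeckeCharacter) : Prop :=
  ∀ 𝔓 : Ideal GaussianInt, 𝔓.IsPrime → 𝔓 ≠ ⊥ →
    ∃ z ∈ 𝔓, GaussianInt.toComplex z = χ.toHom 𝔓

/-!
Let `φ = ψ²` be the quadratic character and let `J = ∑ φ(x) ψ(1 - x)` be the Jacobi sum of `φ` and
`ψ`. Up to the factor `ψ(-1) / p`, the hypergeometric function is `S(a) = ∑ ψ(y(1 - y)(1 - ay))`.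

The substitution `y ↦ 1 / (ay)` gives `S(a) = φ(a) S(a)`, and `y ↦ 1 - y` gives
`S(a) = ψ(1 - a) S(a / (a - 1))`. Together they show that `S(a) = 0` unless `a` and `1 - a` are both
squares (`legendreSum_eq_zero`). If `a = b²`, then `y = z / b` turns `S(a)` into a sum of `φ(z)`
times a function of `t = z + 1 / z`. Since the values of `φ(z)` over the fibre of `t` add up to
`φ(t + 2) + φ(t - 2)`, two affine substitutions yield `S(b²) = ψ(-1) (φ(1 + b) + φ(1 - b)) J`
(`legendreSum_sq`). It remains to see that `χ(𝔭) = -J`.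

As `ψ(x) ≡ x ^ ((p - 1) / 4)` modulo `𝔭`, the sum `J` is congruent modulo `𝔭` to a power sum of
degree less than `p - 1`, so that `J ∈ 𝔭`; with `J J̄ = p` this means `𝔭 = (J)`
(`IsQuarticCharacterAt.exists_jacobiSum_eq`). Counting the points of `y² = x³ - x` over `𝔽_p` by
means of `φ(x) = ψ(x²)` gives `a_p = -(J + J̄)`. On the other hand, the coefficients of `L(χ, s)` at
`p` and `p²` are `χ(𝔭) + χ(𝔭̄)` and `χ(𝔭)² + χ(𝔭) χ(𝔭̄) + χ(𝔭̄)²`, and those of `L(E, s)` are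
`a_p` and `a_p² - p`. Hence `χ(𝔭) χ(𝔭̄) = p`, so `χ(𝔭)` is `-J` or `-J̄`, and the normalization `χ(𝔭) ∈ 𝔭`
leaves only `-J` (`GaussianHeckeCharacter.toHom_eq_neg_jacobiSum`).

The `L`-function of `E` is defined through an arbitrarily chosen minimal Weierstrass equation at
each place. At a place where `2`, `3` and the discriminant are units, every change of variables from
the given equation to a minimal one is integral (`exists_variableChange_of_isUnit_Δ`), so the
reduction has as many points as `y² = x³ - x`.
-/

/-! ### Character sums over finite fields -/

section CharacterSums

open Finset

lemma MulChar.map_neg_one_sq {F R : Type*} [Field F] [CommRing R] (ψ : MulChar F R) :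
    ψ (-1) ^ 2 = 1 := by
  rw [← map_pow]; simp

lemma MulChar.apply_pow_four_eq_one {F : Type*} [Field F] {ψ : MulChar F ℂ}
    (hψ : ψ ^ 4 = 1) {y : F} (hy : y ≠ 0) :
    ψ y ^ 4 = 1 := by
  rw [← MulChar.pow_apply' _ (by norm_num), hψ, MulChar.one_apply hy.isUnit]

variable {F : Type*} [Field F] [Fintype F]

/-- The complex-valued quadratic character of a finite field. -/
noncomputable def complexQuadraticChar (F : Type*) [Field F] [Fintype F] : MulChar F ℂ := by
  classical exact (quadraticChar F).ringHomComp (Int.castRingHom ℂ)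

lemma complexQuadraticChar_apply [DecidableEq F] (x : F) :
    complexQuadraticChar F x = (quadraticChar F x : ℂ) := by
  unfold complexQuadraticChar
  simp only [MulChar.ringHomComp_apply, eq_intCast]
  congr!

lemma quadChar_eq_complexQuadraticChar (p : ℕ) [Fact p.Prime] :
    quadChar p = complexQuadraticChar (ZMod p) := by
  ext x
  rw [complexQuadraticChar_apply]
  simp [quadChar]

lemma complexQuadraticChar_sq {x : F} (hx : x ≠ 0) : complexQuadraticChar F (x ^ 2) = 1 := by
  classical
  rw [complexQuadraticChar_apply, quadraticChar_sq_one' hx, Int.cast_one]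

lemma complexQuadraticChar_of_isSquare {x : F} (hx : x ≠ 0) (h : IsSquare x) :
    complexQuadraticChar F x = 1 := by
  obtain ⟨y, rfl⟩ := h
  rw [← sq]
  exact complexQuadraticChar_sq (by rintro rfl; simp at hx)

lemma complexQuadraticChar_of_not_isSquare {x : F} (h : ¬ IsSquare x) :
    complexQuadraticChar F x = -1 := by
  classical
  rw [complexQuadraticChar_apply, quadraticChar_neg_one_iff_not_isSquare.mpr h]
  simp

/-- The sum `∑ ψ(y(1 - y)(1 - ay))`, which for a quartic character `ψ` is the character sum in the
hypergeometric function with parameters `ψ⁻¹, ψ; ψ²`. -/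
noncomputable def legendreSum (ψ : MulChar F ℂ) (a : F) : ℂ :=
  ∑ y : F, ψ (y * (1 - y) * (1 - a * y))

lemma isSquare_neg_one_of_sq_eq {ψ : MulChar F ℂ} (hψ : ψ ^ 2 = complexQuadraticChar F) :
    IsSquare (-1 : F) := by
  by_contra hneg
  have h1 := MulChar.map_neg_one_sq ψ
  rw [← MulChar.pow_apply' _ two_ne_zero, hψ, complexQuadraticChar_of_not_isSquare hneg] at h1
  norm_num at h1

/-- The involution `y ↦ 1 / (ay)` multiplies `y(1 - y)(1 - ay)` by `1 / (a²y⁴)`. -/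
lemma legendreSum_eq_mul_self {ψ : MulChar F ℂ} (hψ : ψ ^ 4 = 1) {a : F} (ha : a ≠ 0) :
    legendreSum ψ a = (ψ ^ 2) a * legendreSum ψ a := by
  let e : F ≃ F := (Equiv.mulLeft₀ a ha).trans (Equiv.inv F)
  have he (y : F) : e y = (a * y)⁻¹ := rfl
  conv_rhs => rw [legendreSum, ← e.sum_comp]
  rw [legendreSum, mul_sum]
  refine sum_congr rfl fun y _ ↦ ?_
  rw [he]
  rcases eq_or_ne y 0 with rfl | hy
  · simp [MulChar.map_zero]
  have key : y * (1 - y) * (1 - a * y) =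
      a ^ 2 * y ^ 4 * ((a * y)⁻¹ * (1 - (a * y)⁻¹) * (1 - a * (a * y)⁻¹)) := by
    field_simp
    ring
  rw [key, map_mul, map_mul ψ (a ^ 2), map_pow, map_pow, MulChar.apply_pow_four_eq_one hψ hy,
    MulChar.pow_apply' _ two_ne_zero]
  ring

/-- The substitution `y ↦ 1 - y`. -/
lemma legendreSum_eq_mul_div_sub_one (ψ : MulChar F ℂ) {a : F} (ha : a ≠ 1) :
    legendreSum ψ a = ψ (1 - a) * legendreSum ψ (a / (a - 1)) := by
  have h1 : a - 1 ≠ 0 := sub_ne_zero.mpr ha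
  rw [legendreSum, ← (Equiv.subLeft (1 : F)).sum_comp, legendreSum, mul_sum]
  refine sum_congr rfl fun y _ ↦ ?_
  rw [← map_mul]
  congr 1
  simp only [Equiv.subLeft_apply]
  field_simp
  ring

lemma legendreSum_eq_zero {ψ : MulChar F ℂ} (hψ : ψ ^ 2 = complexQuadraticChar F)
    (hψ4 : ψ ^ 4 = 1) {a : F} (ha0 : a ≠ 0) (ha1 : a ≠ 1)
    (h : ¬ IsSquare a ∨ ¬ IsSquare (1 - a)) : legendreSum ψ a = 0 := by
  have key {c : F} (hc : c ≠ 0) (hsq : ¬ IsSquare c) : legendreSum ψ c = 0 := by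
    have := legendreSum_eq_mul_self hψ4 hc
    rw [hψ, complexQuadraticChar_of_not_isSquare hsq] at this
    linear_combination this / 2
  by_cases hsq : IsSquare a
  · rw [legendreSum_eq_mul_div_sub_one ψ ha1, key (div_ne_zero ha0 (sub_ne_zero.mpr ha1)), mul_zero]
    replace h := h.resolve_left (not_not.mpr hsq)
    intro h'
    have hneg := isSquare_neg_one_of_sq_eq hψ
    apply h
    have : 1 - a = -1 * (a / (a / (a - 1))) := by
      have := sub_ne_zero.mpr ha1
      field_simp
      ring
    rw [this]
    exact hneg.mul (hsq.div h')
  · exact key ha0 hsq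

/-- The number of ways of writing `t = z + 1/z`, weighted by the quadratic character of `z`. -/
lemma sum_quadraticChar_fiber_add_inv [DecidableEq F] (h2 : ringChar F ≠ 2)
    (hneg : IsSquare (-1 : F)) (t : F) :
    ∑ z with z ≠ 0 ∧ z + z⁻¹ = t, quadraticChar F z =
      quadraticChar F (t + 2) + quadraticChar F (t - 2) := by
  have h20 : (2 : F) ≠ 0 := Ring.two_ne_zero h2
  have hneg1 : quadraticChar F (-1) = 1 := (quadraticChar_one_iff_isSquare (by simp)).mpr hneg
  have h4 : quadraticChar F 4 = 1 := by
    rw [show (4 : F) = 2 ^ 2 by norm_num]; exact quadraticChar_sq_one' h20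
  by_cases ht : t = 2
  · subst ht
    have : ({z | z ≠ 0 ∧ z + z⁻¹ = 2} : Finset F) = {1} := by
      ext z
      simp only [mem_filter, mem_univ, true_and, mem_singleton]
      constructor
      · rintro ⟨hz, h⟩
        field_simp at h
        have : (z - 1) ^ 2 = 0 := by linear_combination h
        exact sub_eq_zero.mp (pow_eq_zero_iff two_ne_zero |>.mp this)
      · rintro rfl; norm_num
    rw [this, sum_singleton, sub_self, show (2 : F) + 2 = 4 by norm_num, h4]
    simp
  by_cases ht' : t = -2
  · subst ht'
    have : ({z | z ≠ 0 ∧ z + z⁻¹ = -2} : Finset F) = {-1} := by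
      ext z
      simp only [mem_filter, mem_univ, true_and, mem_singleton]
      constructor
      · rintro ⟨hz, h⟩
        field_simp at h
        have : (z + 1) ^ 2 = 0 := by linear_combination h
        exact eq_neg_of_add_eq_zero_left (pow_eq_zero_iff two_ne_zero |>.mp this)
      · rintro rfl; norm_num
    rw [this, sum_singleton, show (-2 : F) + 2 = 0 by norm_num,
      show (-2 : F) - 2 = -1 * 4 by norm_num, map_mul, h4, hneg1]
    simp
  have hp : t + 2 ≠ 0 := fun h ↦ ht' (eq_neg_of_add_eq_zero_left h)
  have hm : t - 2 ≠ 0 := sub_ne_zero.mpr ht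
  -- `(t + 2) z = (z + 1)²`, so the character is constant on the fibre
  have hval : ∀ z ∈ ({z | z ≠ 0 ∧ z + z⁻¹ = t} : Finset F),
      quadraticChar F z = quadraticChar F (t + 2) := by
    intro z hz
    simp only [mem_filter, mem_univ, true_and] at hz
    obtain ⟨hz, rfl⟩ := hz
    have h1 : (z + z⁻¹ + 2) * z = (z + 1) ^ 2 := by field_simp; ring
    have h2 : quadraticChar F ((z + z⁻¹ + 2) * z) = 1 := by
      rw [h1]
      refine quadraticChar_sq_one' fun h ↦ ?_
      rw [h, zero_pow two_ne_zero] at h1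
      exact mul_ne_zero hp hz h1
    rw [map_mul] at h2
    rcases quadraticChar_dichotomy hz with h | h <;>
    rcases quadraticChar_dichotomy hp with h' | h' <;> simp_all
  rw [sum_congr rfl hval, sum_const, nsmul_eq_mul]
  -- `z ↦ 2z - t` maps the fibre to the square roots of `t² - 4`
  have hcard : ((#({z | z ≠ 0 ∧ z + z⁻¹ = t} : Finset F) : ℕ) : ℤ) =
      quadraticChar F (t ^ 2 - 4) + 1 := by
    rw [← quadraticChar_card_sqrts h2]
    norm_cast
    refine card_bij' (fun z _ ↦ 2 * z - t) (fun d _ ↦ (d + t) / 2) ?_ ?_ ?_ ?_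
    · intro z hz
      simp only [mem_filter, mem_univ, true_and] at hz
      obtain ⟨hz, rfl⟩ := hz
      simp only [Set.mem_toFinset, Set.mem_ofPred_eq]
      field_simp
      ring
    · intro d hd
      simp only [Set.mem_toFinset, Set.mem_ofPred_eq] at hd
      have hne : d + t ≠ 0 := by
        intro h
        have : d = -t := eq_neg_of_add_eq_zero_left h
        rw [this] at hd
        have h4 : (4 : F) = 0 := by linear_combination hd
        have : (2 : F) ^ 2 = 0 := by linear_combination h4
        exact h20 (pow_eq_zero_iff two_ne_zero |>.mp this)
      simp only [mem_filter, mem_univ, true_and]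
      refine ⟨div_ne_zero hne h20, ?_⟩
      field_simp
      linear_combination hd
    · intro z _
      field_simp
      ring
    · intro d _
      field_simp
      ring
  rw [hcard, show t ^ 2 - 4 = (t + 2) * (t - 2) by ring, map_mul]
  rcases quadraticChar_dichotomy hp with h | h <;>
  rcases quadraticChar_dichotomy hm with h' | h' <;> simp [h, h']

lemma sum_complexQuadraticChar_mul_add_inv (h2 : ringChar F ≠ 2) (hneg : IsSquare (-1 : F))
    (g : F → ℂ) :
    ∑ z, complexQuadraticChar F z * g (z + z⁻¹) =
      ∑ t, (complexQuadraticChar F (t + 2) + complexQuadraticChar F (t - 2)) * g t := by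
  classical
  calc ∑ z, complexQuadraticChar F z * g (z + z⁻¹)
      = ∑ z with z ≠ 0, complexQuadraticChar F z * g (z + z⁻¹) := by
        refine (sum_filter_of_ne fun z _ hz ↦ ?_).symm
        rintro rfl
        simp [MulChar.map_zero] at hz
    _ = ∑ t, ∑ z with z ≠ 0 ∧ z + z⁻¹ = t, complexQuadraticChar F z * g (z + z⁻¹) := by
        rw [← sum_fiberwise _ fun z : F ↦ z + z⁻¹]
        simp only [filter_filter]
    _ = _ := by
        refine sum_congr rfl fun t _ ↦ ?_
        have := congrArg (Int.cast (R := ℂ)) (sum_quadraticChar_fiber_add_inv h2 hneg t)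
        push_cast at this
        simp only [complexQuadraticChar_apply]
        rw [← this, sum_mul]
        refine sum_congr rfl fun z hz ↦ ?_
        simp only [mem_filter, mem_univ, true_and] at hz
        rw [hz.2]

/-- An affine substitution turns this sum into a Jacobi sum. -/
lemma sum_complexQuadraticChar_add_two_mul {ψ : MulChar F ℂ}
    (hψ : ψ ^ 2 = complexQuadraticChar F) {b : F} (hb : b ≠ 0) (hb1 : 1 + b ≠ 0) :
    ∑ t, complexQuadraticChar F (t + 2) * ψ (b * t - (1 + b ^ 2)) =
      complexQuadraticChar F b * complexQuadraticChar F (1 + b) * ψ (-1) *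
        jacobiSum (complexQuadraticChar F) ψ := by
  have hc : (1 + b) ^ 2 / b ≠ 0 := div_ne_zero (pow_ne_zero _ hb1) hb
  let e : F ≃ F := (Equiv.mulLeft₀ _ hc).trans (Equiv.subRight 2)
  have he (v : F) : e v = (1 + b) ^ 2 / b * v - 2 := rfl
  rw [← e.sum_comp, jacobiSum, mul_sum]
  refine sum_congr rfl fun v _ ↦ ?_
  have h1 : e v + 2 = b * v * ((1 + b) / b) ^ 2 := by rw [he]; field_simp; ring
  have h2 : b * e v - (1 + b ^ 2) = -1 * (1 + b) ^ 2 * (1 - v) := by rw [he]; field_simp; ring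
  rw [h1, h2]
  simp only [map_mul]
  rw [complexQuadraticChar_sq (div_ne_zero hb1 hb), map_pow ψ (1 + b),
    ← MulChar.pow_apply' _ two_ne_zero, hψ]
  ring

lemma legendreSum_sq (h2 : ringChar F ≠ 2) {ψ : MulChar F ℂ}
    (hψ : ψ ^ 2 = complexQuadraticChar F) {b : F} (hb : b ≠ 0) (hb1 : 1 - b ^ 2 ≠ 0) :
    legendreSum ψ (b ^ 2) = ψ (-1) * (complexQuadraticChar F (1 + b) +
      complexQuadraticChar F (1 - b)) * jacobiSum (complexQuadraticChar F) ψ := by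
  have hneg := isSquare_neg_one_of_sq_eq hψ
  have hprod : (1 - b) * (1 + b) ≠ 0 := by convert hb1 using 1; ring
  have hφneg : complexQuadraticChar F (-1) = 1 :=
    complexQuadraticChar_of_isSquare (by simp) hneg
  have hφb : complexQuadraticChar F b * complexQuadraticChar F b = 1 := by
    rw [← map_mul, ← sq, complexQuadraticChar_sq hb]
  have hS : legendreSum ψ (b ^ 2) = complexQuadraticChar F b *
      ∑ z, complexQuadraticChar F z * ψ (b * (z + z⁻¹) - (1 + b ^ 2)) := by
    rw [legendreSum, ← Equiv.sum_comp (Equiv.mulLeft₀ _ (inv_ne_zero hb)), mul_sum]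
    refine sum_congr rfl fun z _ ↦ ?_
    change ψ (b⁻¹ * z * (1 - b⁻¹ * z) * (1 - b ^ 2 * (b⁻¹ * z))) = _
    rcases eq_or_ne z 0 with rfl | hz
    · simp [MulChar.map_zero]
    have key : b⁻¹ * z * (1 - b⁻¹ * z) * (1 - b ^ 2 * (b⁻¹ * z)) =
        (b * z * b⁻¹ ^ 2) ^ 2 * (b * (z + z⁻¹) - (1 + b ^ 2)) := by
      field_simp
      ring
    rw [key, map_mul, map_pow, ← MulChar.pow_apply' _ two_ne_zero, hψ, map_mul, map_mul,
      complexQuadraticChar_sq (inv_ne_zero hb)]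
    ring
  have hflip : ∑ t, complexQuadraticChar F (t - 2) * ψ (b * t - (1 + b ^ 2)) =
      ∑ t, complexQuadraticChar F (t + 2) * ψ (-b * t - (1 + (-b) ^ 2)) := by
    rw [← Equiv.sum_comp (Equiv.neg F)]
    refine sum_congr rfl fun t _ ↦ ?_
    rw [Equiv.neg_apply, show -t - 2 = -1 * (t + 2) by ring, map_mul, hφneg, one_mul]
    congr 2
    ring
  rw [hS, sum_complexQuadraticChar_mul_add_inv h2 hneg fun t ↦ ψ (b * t - (1 + b ^ 2))]
  simp only [add_mul, sum_add_distrib]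
  rw [hflip, sum_complexQuadraticChar_add_two_mul hψ hb (right_ne_zero_of_mul hprod),
    sum_complexQuadraticChar_add_two_mul hψ (neg_ne_zero.mpr hb)
      (by simpa [sub_eq_add_neg] using left_ne_zero_of_mul hprod),
    neg_eq_neg_one_mul b, map_mul, hφneg, neg_one_mul, ← sub_eq_add_neg]
  linear_combination (complexQuadraticChar F (1 + b) + complexQuadraticChar F (1 - b)) * ψ (-1) *
    jacobiSum (complexQuadraticChar F) ψ * hφb

lemma hypergeom2F1_eq_legendreSum {ψ φ : MulChar F ℂ} (hψ : ψ ^ 2 = φ) (hneg : φ (-1) = 1)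
    {a : F} (ha : a ≠ 0) :
    hypergeom2F1 ψ⁻¹ ψ φ a = ψ (-1) / Fintype.card F * legendreSum ψ a := by
  have h : φ * ψ⁻¹ = ψ := by rw [← hψ, sq, mul_assoc, mul_inv_cancel, mul_one]
  rw [hypergeom2F1, h, inv_inv, MulChar.one_apply ha.isUnit, MulChar.mul_apply, hneg, legendreSum]
  simp only [map_mul, one_mul, mul_one]

/-- The sum over the curve `y² = x³ - x` in terms of Jacobi sums: substitute `u = x²` and use
`φ(x) = ψ(x²)`. -/
lemma sum_complexQuadraticChar_cube_sub_self (h2 : ringChar F ≠ 2) {ψ : MulChar F ℂ}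
    (hψ : ψ ^ 2 = complexQuadraticChar F) (hψ4 : ψ ^ 4 = 1) :
    ∑ x, complexQuadraticChar F (x ^ 3 - x) =
      jacobiSum (complexQuadraticChar F) ψ + jacobiSum (complexQuadraticChar F) ψ⁻¹ := by
  classical
  have hφneg : complexQuadraticChar F (-1) = 1 :=
    complexQuadraticChar_of_isSquare (by simp) (isSquare_neg_one_of_sq_eq hψ)
  have hinv : ψ * complexQuadraticChar F = ψ⁻¹ := by
    rw [← hψ, ← pow_succ', eq_inv_iff_mul_eq_one, ← pow_succ, hψ4]
  calc ∑ x, complexQuadraticChar F (x ^ 3 - x)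
      = ∑ x, ψ (x ^ 2) * complexQuadraticChar F (1 - x ^ 2) := by
        refine sum_congr rfl fun x _ ↦ ?_
        rw [show x ^ 3 - x = -1 * (x * (1 - x ^ 2)) by ring, map_mul, map_mul, hφneg, map_pow ψ,
          ← MulChar.pow_apply' _ two_ne_zero, hψ, one_mul]
    _ = ∑ u, ∑ x with x ^ 2 = u, ψ (x ^ 2) * complexQuadraticChar F (1 - x ^ 2) :=
        (sum_fiberwise _ _ _).symm
    _ = ∑ u, ((quadraticChar F u : ℂ) + 1) * (ψ u * complexQuadraticChar F (1 - u)) := by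
        refine sum_congr rfl fun u _ ↦ ?_
        have hc := congrArg (Int.cast (R := ℂ)) (quadraticChar_card_sqrts h2 u)
        push_cast at hc
        rw [← hc, ← nsmul_eq_mul, ← sum_const]
        refine sum_congr (by ext; simp) fun x hx ↦ ?_
        rw [(by simpa using hx : x ^ 2 = u)]
    _ = _ := by
        rw [jacobiSum_comm, jacobiSum_comm _ ψ⁻¹, ← hinv, jacobiSum, jacobiSum, ← sum_add_distrib]
        refine sum_congr rfl fun u _ ↦ ?_
        rw [MulChar.mul_apply, complexQuadraticChar_apply u]
        ring

end CharacterSums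

/-! ### Good reduction and minimal Weierstrass equations -/

section Reduction

open WeierstrassCurve

lemma card_point_eq_card_equation_add_one {k : Type*} [Field k] [Finite k]
    (W : WeierstrassCurve k) (hΔ : W.Δ ≠ 0) :
    Nat.card W.toAffine.Point =
      Nat.card {xy : k × k // W.toAffine.Equation xy.1 xy.2} + 1 := by
  classical
  have : W.IsElliptic := ⟨hΔ.isUnit⟩
  have e : W.toAffine.Point ≃ Option {xy : k × k // W.toAffine.Equation xy.1 xy.2} :=
    Affine.pointEquiv W.toAffine
  rw [Nat.card_congr e, Finite.card_option]

/-- A change of variables induces a bijection between affine points. -/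
lemma card_equation_variableChange {k : Type*} [Field k] (W : WeierstrassCurve k)
    (C : VariableChange k) :
    Nat.card {xy : k × k // (C • W).toAffine.Equation xy.1 xy.2} =
      Nat.card {xy : k × k // W.toAffine.Equation xy.1 xy.2} := by
  have hu : (C.u : k) ≠ 0 := C.u.ne_zero
  let e : k × k ≃ k × k :=
    { toFun := fun xy ↦ (C.u ^ 2 * xy.1 + C.r, C.u ^ 3 * xy.2 + C.u ^ 2 * C.s * xy.1 + C.t)
      invFun := fun xy ↦ ((xy.1 - C.r) / C.u ^ 2,
        (xy.2 - C.s * (xy.1 - C.r) - C.t) / C.u ^ 3)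
      left_inv := fun xy ↦ by
        ext
        · simp only; field_simp; ring
        · simp only; field_simp; ring
      right_inv := fun xy ↦ by
        ext
        · simp only; field_simp; ring
        · simp only; field_simp; ring }
  refine Nat.card_congr (e.subtypeEquiv fun xy ↦ ?_)
  obtain ⟨x, y⟩ := xy
  rw [Affine.equation_iff', Affine.equation_iff', variableChange_def]
  simp only [e, Equiv.coe_fn_mk, Units.val_inv_eq_inv_val]
  rw [← mul_right_inj' (pow_ne_zero 6 hu), mul_zero]
  refine Eq.congr ?_ rfl
  field_simp
  ring

variable {R : Type*} [CommRing R] [IsDomain R] {K : Type*} [Field K] [Algebra R K]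
  [IsFractionRing R K]

omit [IsDomain R] in
/-- If `2` and `3` are invertible, then a change of variables over the fraction field between two
Weierstrass equations with unit discriminant is defined over the ring: `u` is integral because
`u¹²` is a quotient of discriminants, and `r`, `s`, `t` are then read off `b₂`, `a₁`, `a₃`. -/
lemma exists_variableChange_of_isUnit_Δ [IsIntegrallyClosed R] (W W' : WeierstrassCurve R)
    (D : VariableChange K) (hD : D • W.map (algebraMap R K) = W'.map (algebraMap R K))
    (h2 : IsUnit (2 : R)) (h3 : IsUnit (3 : R)) (hΔ : IsUnit W.Δ) (hΔ' : IsUnit W'.Δ) :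
    ∃ C : VariableChange R, C • W = W' := by
  have hinj : Function.Injective (algebraMap R K) := IsFractionRing.injective R K
  have hu : (D.u : K) ≠ 0 := D.u.ne_zero
  have hdisc : D.u⁻¹ ^ 12 * algebraMap R K W.Δ = algebraMap R K W'.Δ := by
    rw [← map_Δ, ← map_Δ, ← hD, variableChange_Δ]
  obtain ⟨d, hd⟩ := hΔ
  obtain ⟨d', hd'⟩ := hΔ'
  obtain ⟨v, hv⟩ := IsIntegrallyClosed.exists_algebraMap_eq_of_isIntegral_pow
    (R := R) (x := ((D.u⁻¹ : Kˣ) : K)) (n := 12) (by norm_num) (by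
      have : ((D.u⁻¹ : Kˣ) : K) ^ 12 = algebraMap R K (d' * ↑d⁻¹) := by
        rw [map_mul, hd', ← hdisc, ← hd, mul_assoc, ← map_mul, Units.mul_inv, map_one, mul_one]
      rw [this]
      exact isIntegral_algebraMap)
  have hvu : IsUnit v := by
    refine IsUnit.of_mul_eq_one (v ^ 11 * d * ↑d'⁻¹) (hinj ?_)
    rw [← hd, ← hd', ← hv] at hdisc
    have : algebraMap R K (d' : R) * algebraMap R K (↑d'⁻¹ : R) = 1 := by
      rw [← map_mul, Units.mul_inv, map_one]
    simp only [map_mul, map_pow, map_one]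
    linear_combination algebraMap R K (↑d'⁻¹ : R) * hdisc + this
  obtain ⟨v, rfl⟩ := hvu
  set u : Rˣ := v⁻¹ with hu_def
  have hvinv : algebraMap R K (v : R) * algebraMap R K (u : R) = 1 := by
    rw [← map_mul, hu_def, Units.mul_inv, map_one]
  have hDu : (D.u : K) = algebraMap R K (u : R) := by
    have : (D.u : K) * ((D.u⁻¹ : Kˣ) : K) = 1 := Units.mul_inv _
    rw [← hv] at this
    linear_combination algebraMap R K (u : R) * this - D.u * hvinv
  have hv' : ((D.u⁻¹ : Kˣ) : K) = (algebraMap R K (u : R))⁻¹ := by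
    rw [← hDu, Units.val_inv_eq_inv_val]
  have hu0 : algebraMap R K (u : R) ≠ 0 := hDu ▸ hu
  obtain ⟨i2, hi2⟩ := h2.exists_left_inv
  obtain ⟨i3, hi3⟩ := h3.exists_left_inv
  have hi2' : algebraMap R K i2 * 2 = 1 := by
    rw [← map_ofNat (algebraMap R K) 2, ← map_mul, hi2, map_one]
  have hi3' : algebraMap R K i3 * 3 = 1 := by
    rw [← map_ofNat (algebraMap R K) 3, ← map_mul, hi3, map_one]
  have eb2 : (D • W.map (algebraMap R K)).b₂ = algebraMap R K W'.b₂ := by rw [hD, map_b₂]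
  have ea1 : (D • W.map (algebraMap R K)).a₁ = algebraMap R K W'.a₁ := by rw [hD, map_a₁]
  have ea3 : (D • W.map (algebraMap R K)).a₃ = algebraMap R K W'.a₃ := by rw [hD, map_a₃]
  rw [variableChange_b₂, map_b₂, hv'] at eb2
  rw [variableChange_a₁, map_a₁, hv'] at ea1
  rw [variableChange_a₃, map_a₁, map_a₃, hv'] at ea3
  field_simp at eb2 ea1 ea3
  have hr : D.r = algebraMap R K (i2 ^ 2 * i3 * (u ^ 2 * W'.b₂ - W.b₂)) := by
    simp only [map_mul, map_sub, map_pow]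
    linear_combination (algebraMap R K i2) ^ 2 * algebraMap R K i3 * eb2 -
      D.r * (4 * (algebraMap R K i2) ^ 2 * hi3' + (2 * algebraMap R K i2 + 1) * hi2')
  have hs : D.s = algebraMap R K (i2 * (u * W'.a₁ - W.a₁)) := by
    simp only [map_mul, map_sub]
    linear_combination (algebraMap R K i2) * ea1 - D.s * hi2'
  have ht : D.t = algebraMap R K
      (i2 * (u ^ 3 * W'.a₃ - W.a₃ - i2 ^ 2 * i3 * (u ^ 2 * W'.b₂ - W.b₂) * W.a₁)) := by
    rw [map_mul, map_sub, map_mul _ _ W.a₁, ← hr]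
    simp only [map_mul, map_sub, map_pow]
    linear_combination (algebraMap R K i2) * ea3 - D.t * hi2'
  refine ⟨⟨u, i2 ^ 2 * i3 * (u ^ 2 * W'.b₂ - W.b₂), i2 * (u * W'.a₁ - W.a₁),
    i2 * (u ^ 3 * W'.a₃ - W.a₃ - i2 ^ 2 * i3 * (u ^ 2 * W'.b₂ - W.b₂) * W.a₁)⟩,
    map_injective hinj ?_⟩
  change (_ : WeierstrassCurve R).map (algebraMap R K) = W'.map (algebraMap R K)
  rw [← map_variableChange, ← hD]
  congr 1
  ext
  · simpa using hDu.symm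
  · exact hr.symm
  · exact hs.symm
  · exact ht.symm

section DVR

variable [IsDiscreteValuationRing R]

/-- A Weierstrass equation with integral coefficients and unit discriminant has good reduction, and
any minimal equation is an integral change of variables of it. -/
lemma minimal_of_isUnit_Δ (W : WeierstrassCurve R) (h2 : IsUnit (2 : R)) (h3 : IsUnit (3 : R))
    (hΔ : IsUnit W.Δ) :
    ((W.map (algebraMap R K)).minimal R).HasGoodReduction R ∧
      ∃ C : VariableChange R, ((W.map (algebraMap R K)).minimal R).reduction R =
        (C • W).map (IsLocalRing.residue R) := by
  have hinj : Function.Injective (algebraMap R K) := IsFractionRing.injective R K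
  set V := W.map (algebraMap R K) with hV
  obtain ⟨D, hD⟩ : ∃ D : VariableChange K, V.minimal R = D • V := ⟨_, rfl⟩
  set M := V.minimal R with hM
  have hint : IsIntegral R V := ⟨W, rfl⟩
  have hDM : D⁻¹ • M = V := by rw [hD, inv_smul_smul]
  have hval_unit {r : R} (hr : IsUnit r) :
      IsDedekindDomain.HeightOneSpectrum.valuation K
        (IsDiscreteValuationRing.maximalIdeal R) (algebraMap R K r) = 1 := by
    rw [IsDedekindDomain.HeightOneSpectrum.valuation_eq_one_iff_notMem]
    exact fun h ↦ (IsLocalRing.mem_maximalIdeal r).mp h hr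
  -- the valuation of the discriminant of `V` is already the largest possible, so that of the
  -- minimal equation `M` is the same
  have hgood : M.HasGoodReduction R := by
    refine ⟨?_⟩
    have hmax := (IsMinimal.val_Δ_maximal (R := R) (W := M)).2 (j := D⁻¹)
      (show IsIntegral R (D⁻¹ • M) by rwa [hDM])
    have hle : (valuation_Δ_aux R ((1 : VariableChange K) • M)) ≤
        valuation_Δ_aux R (D⁻¹ • M) := by
      rw [hDM, one_smul, ← Subtype.coe_le_coe, valuation_Δ_aux_eq_of_isIntegral R V, hV, map_Δ, hval_unit hΔ]
      exact (valuation_Δ_aux R _).2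
    have hge : valuation_Δ_aux R (D⁻¹ • M) ≤ valuation_Δ_aux R ((1 : VariableChange K) • M) :=
      hmax hle
    rw [hDM, one_smul, ← Subtype.coe_le_coe, valuation_Δ_aux_eq_of_isIntegral,
      valuation_Δ_aux_eq_of_isIntegral, hV, map_Δ, hval_unit hΔ] at hge
    refine le_antisymm ?_ hge
    rw [← valuation_Δ_aux_eq_of_isIntegral]
    exact (valuation_Δ_aux R _).2
  refine ⟨hgood, ?_⟩
  have hI : IsUnit (M.integralModel R).Δ := by
    have := hgood.goodReduction
    rw [← integralModel_Δ_eq R M,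
      IsDedekindDomain.HeightOneSpectrum.valuation_eq_one_iff_notMem] at this
    by_contra h
    exact this ((IsLocalRing.mem_maximalIdeal _).mpr h)
  obtain ⟨C, hC⟩ := exists_variableChange_of_isUnit_Δ W (M.integralModel R) D
    (by rw [← hV, ← hD]; exact (baseChange_integralModel_eq R M).symm) h2 h3 hΔ hI
  exact ⟨C, by rw [hC]; rfl⟩

lemma localPolynomial_of_isUnit_Δ [Finite (IsLocalRing.ResidueField R)] (W : WeierstrassCurve R)
    (h2 : IsUnit (2 : R)) (h3 : IsUnit (3 : R)) (hΔ : IsUnit W.Δ) :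
    (W.map (algebraMap R K)).localPolynomial R =
      1 - Polynomial.C ((Nat.card (IsLocalRing.ResidueField R) : ℤ) -
        Nat.card {xy : IsLocalRing.ResidueField R × IsLocalRing.ResidueField R //
          (W.map (IsLocalRing.residue R)).toAffine.Equation xy.1 xy.2}) * Polynomial.X +
      Polynomial.C (Nat.card (IsLocalRing.ResidueField R) : ℤ) * Polynomial.X ^ 2 := by
  obtain ⟨hgood, C, hC⟩ := minimal_of_isUnit_Δ (K := K) W h2 h3 hΔ
  have hΔ' : ((C • W).map (IsLocalRing.residue R)).Δ ≠ 0 := by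
    rw [map_Δ, variableChange_Δ]
    exact (((C.u⁻¹.isUnit.pow 12).mul hΔ).map _).ne_zero
  rw [localPolynomial, if_pos hgood]
  congr 4
  rw [hC, card_point_eq_card_equation_add_one _ hΔ', ← map_variableChange,
    card_equation_variableChange]
  push_cast
  ring

end DVR

end Reduction

/-! ### Coefficients of Euler products -/

section EulerProduct

namespace ArithmeticFunction

open Filter

/-- If every factor other than `i` has vanishing coefficients at `p, p², …`, then the Euler product
has the same coefficients at the powers of `p` as the `i`-th factor. -/
lemma eulerProduct_ofPowerSeries_apply_prime_pow {ι R : Type*} [CommSemiring R] (q : ι → ℕ)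
    (hq : ∀ i, (q i).Prime) (hinj : Function.Injective q) (f : ι → PowerSeries R)
    (hf : ∀ i, (f i).constantCoeff = 1) (i : ι) (k : ℕ) :
    eulerProduct (fun i ↦ ofPowerSeries (q i) (f i)) (q i ^ k) = (f i).coeff k := by
  classical
  have : Northcott q := ⟨fun b ↦ (Set.finite_Iic b).preimage hinj.injOn⟩
  -- products of the other factors do not see the powers of `q i`
  have htriv (s : Finset ι) (hs : i ∉ s) (j : ℕ) :
      (∏ l ∈ s, ofPowerSeries (q l) (f l)) (q i ^ j) = if j = 0 then 1 else 0 := by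
    induction s using Finset.induction_on generalizing j with
    | empty =>
      rcases eq_or_ne j 0 with rfl | hj
      · simp
      · simp [hj, (hq i).ne_one]
    | insert l s hl ih =>
      have hil : q i ≠ q l := fun h ↦ hs (by simp [hinj h])
      have hl' (m : ℕ) : ofPowerSeries (q l) (f l) (q i ^ m) = if m = 0 then 1 else 0 := by
        rcases eq_or_ne m 0 with rfl | hm
        · simp [hf]
        · rw [if_neg hm, ofPowerSeries_apply (hq l).one_lt, Function.extend_apply']
          · rfl
          · rintro ⟨n, hn⟩
            have hdvd : q i ∣ q l ^ n := by
              change q l ^ n = q i ^ m at hn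
              rw [hn]; exact dvd_pow_self _ hm
            exact hil ((Nat.prime_dvd_prime_iff_eq (hq i) (hq l)).mp
              ((hq i).dvd_of_dvd_pow hdvd))
      rw [Finset.prod_insert hl, mul_apply, Nat.sum_divisorsAntidiagonal
        (fun a b ↦ ofPowerSeries (q l) (f l) a * (∏ x ∈ s, ofPowerSeries (q x) (f x)) b),
        Nat.sum_divisors_prime_pow (hq i), Finset.sum_eq_single 0]
      · rw [hl', pow_zero, Nat.div_one, ih (fun h ↦ hs (Finset.mem_insert_of_mem h))]
        simp
      · intro b _ hb
        rw [hl', if_neg hb, zero_mul]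
      · simp
  obtain ⟨s, hs⟩ := (tendsTo_eulerProduct_ofPowerSeries q f hf (q i ^ k)).exists_forall_of_atTop
  have h := hs (insert i s) (Finset.subset_insert i s)
  rw [← h, ← Finset.mul_prod_erase _ _ (Finset.mem_insert_self i s), mul_apply,
    Nat.sum_divisorsAntidiagonal (fun a b ↦ ofPowerSeries (q i) (f i) a *
      (∏ x ∈ (insert i s).erase i, ofPowerSeries (q x) (f x)) b),
    Nat.sum_divisors_prime_pow (hq i), Finset.sum_eq_single k]
  · rw [Nat.div_self (pow_pos (hq i).pos k), ofPowerSeries_apply_pow (hq i).one_lt]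
    have := htriv ((insert i s).erase i) (Finset.notMem_erase i _) 0
    rw [pow_zero] at this
    rw [this]
    simp
  · intro b hb hbk
    have hbk : b < k := lt_of_le_of_ne (Nat.lt_succ_iff.mp (Finset.mem_range.mp hb)) hbk
    rw [Nat.pow_div hbk.le (hq i).pos, htriv _ (Finset.notMem_erase i _),
      if_neg (Nat.sub_ne_zero_of_lt hbk), mul_zero]
  · simp

end ArithmeticFunction

lemma coeff_invOfUnit_quadratic (a b : ℤ) :
    let P : Polynomial ℤ := 1 - Polynomial.C a * Polynomial.X + Polynomial.C b * Polynomial.X ^ 2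
    (PowerSeries.invOfUnit (P : PowerSeries ℤ) 1).coeff 1 = a ∧
      (PowerSeries.invOfUnit (P : PowerSeries ℤ) 1).coeff 2 = a ^ 2 - b := by
  intro P
  set Q := PowerSeries.invOfUnit (P : PowerSeries ℤ) 1
  have h0 : P.coeff 0 = 1 := by simp [P]
  have h1 : P.coeff 1 = -a := by simp [P, Polynomial.coeff_one, Polynomial.coeff_X_pow]
  have h2 : P.coeff 2 = b := by
    simp [P, Polynomial.coeff_one, -eq_intCast]
  have hPQ : (P : PowerSeries ℤ) * Q = 1 := PowerSeries.mul_invOfUnit _ _ (by simpa using h0)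
  have e0 := congrArg (PowerSeries.coeff 0) hPQ
  have e1 := congrArg (PowerSeries.coeff 1) hPQ
  have e2 := congrArg (PowerSeries.coeff 2) hPQ
  simp only [PowerSeries.coeff_mul, Finset.Nat.antidiagonal_succ, Finset.Nat.antidiagonal_zero,
    Finset.sum_cons, Finset.map_singleton, Finset.map_cons, Finset.sum_singleton,
    Polynomial.coeff_coe, PowerSeries.coeff_one, Function.Embedding.prodMap,
    Function.Embedding.coeFn_mk, Prod.map, Function.Embedding.refl_apply, h0] at e0 e1 e2
  norm_num [h1, h2] at e0 e1 e2
  rw [e0] at e1 e2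
  have e1' : Q.coeff 1 = a := by linear_combination e1
  exact ⟨e1', by rw [e1'] at e2; linear_combination e2⟩

end EulerProduct

/-! ### The coefficients of `L(E, s)` at `p` and `p²` -/

section CurveE

open WeierstrassCurve IsDedekindDomain NumberField

/-- The residue field of the completion of `ℚ` at a finite place is the prime field. -/
noncomputable def residueFieldAdicCompletionIntegersEquiv (v : HeightOneSpectrum (𝓞 ℚ)) :
    IsLocalRing.ResidueField (v.adicCompletionIntegers ℚ) ≃+*
      ZMod (Rat.HeightOneSpectrum.primesEquiv v : ℕ) :=
  haveI : Fact (Rat.HeightOneSpectrum.primesEquiv v : ℕ).Prime :=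
    ⟨(Rat.HeightOneSpectrum.primesEquiv v).2⟩
  (IsLocalRing.ResidueField.mapEquiv
    (Rat.HeightOneSpectrum.adicCompletionIntegers.padicIntEquiv v).toRingEquiv).trans
    PadicInt.residueField

lemma card_residueField_adicCompletionIntegers (v : HeightOneSpectrum (𝓞 ℚ)) :
    Nat.card (IsLocalRing.ResidueField (v.adicCompletionIntegers ℚ)) =
      (Rat.HeightOneSpectrum.primesEquiv v : ℕ) := by
  rw [Nat.card_congr (residueFieldAdicCompletionIntegersEquiv v).toEquiv, Nat.card_zmod]

lemma constantCoeff_localPowerSeries {R K : Type*} [CommRing R] [IsDomain R]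
    [IsDiscreteValuationRing R] [Field K] [Algebra R K] [IsFractionRing R K]
    (W : WeierstrassCurve K) : (W.localPowerSeries R).constantCoeff = 1 := by
  simp [localPowerSeries]

lemma LFunction_apply_prime_pow (W : WeierstrassCurve ℚ) (v : HeightOneSpectrum (𝓞 ℚ)) (k : ℕ) :
    W.LFunction ((Rat.HeightOneSpectrum.primesEquiv v : ℕ) ^ k) =
      ((W.baseChange (v.adicCompletion ℚ)).localPowerSeries
        (v.adicCompletionIntegers ℚ)).coeff k := by
  have := ArithmeticFunction.eulerProduct_ofPowerSeries_apply_prime_pow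
    (fun v : HeightOneSpectrum (𝓞 ℚ) ↦
      Nat.card (IsLocalRing.ResidueField (v.adicCompletionIntegers ℚ)))
    (fun v ↦ by rw [card_residueField_adicCompletionIntegers]; exact (Subtype.prop _))
    (fun v w h ↦ by
      simp only [card_residueField_adicCompletionIntegers] at h
      exact Rat.HeightOneSpectrum.primesEquiv.injective (Subtype.ext h))
    (fun v ↦ (W.baseChange (v.adicCompletion ℚ)).localPowerSeries (v.adicCompletionIntegers ℚ))
    (fun v ↦ constantCoeff_localPowerSeries _) v k
  simp only [card_residueField_adicCompletionIntegers v] at this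
  exact this

/-- The coefficients of `L(E, s)` at `p` and `p²`, in terms of the number of points modulo `p`. -/
lemma curveE_LFunction_apply (p : ℕ) [Fact p.Prime] (hp2 : p ≠ 2) (hp3 : p ≠ 3) :
    let a : ℤ := p - Nat.card {xy : ZMod p × ZMod p // xy.2 ^ 2 = xy.1 ^ 3 - xy.1}
    curveE.LFunction p = a ∧ curveE.LFunction (p ^ 2) = a ^ 2 - p := by
  intro a
  obtain ⟨v, hv⟩ := Rat.HeightOneSpectrum.primesEquiv (R := 𝓞 ℚ).surjective ⟨p, Fact.out⟩
  have hvp : (Rat.HeightOneSpectrum.primesEquiv v : ℕ) = p := by rw [hv]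
  obtain ⟨e⟩ : Nonempty (IsLocalRing.ResidueField (v.adicCompletionIntegers ℚ) ≃+* ZMod p) :=
    ⟨hvp ▸ residueFieldAdicCompletionIntegersEquiv v⟩
  have : Finite (IsLocalRing.ResidueField (v.adicCompletionIntegers ℚ)) :=
    Finite.of_equiv _ e.symm.toEquiv
  have hcard : Nat.card (IsLocalRing.ResidueField (v.adicCompletionIntegers ℚ)) = p := by
    rw [card_residueField_adicCompletionIntegers, hvp]
  have hunit (n : ℕ) (hn : ¬ p ∣ n) : IsUnit (n : v.adicCompletionIntegers ℚ) := by
    rw [← IsLocalRing.residue_ne_zero_iff_isUnit]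
    intro h
    apply hn
    have := congrArg e h
    rwa [map_natCast, map_natCast, map_zero, ZMod.natCast_eq_zero_iff] at this
  have h2 : IsUnit (2 : v.adicCompletionIntegers ℚ) := by
    refine mod_cast hunit 2 fun h ↦ hp2 ((Nat.prime_dvd_prime_iff_eq Fact.out Nat.prime_two).mp h)
  have h3 : IsUnit (3 : v.adicCompletionIntegers ℚ) := by
    refine mod_cast hunit 3 fun h ↦ hp3 ((Nat.prime_dvd_prime_iff_eq Fact.out Nat.prime_three).mp h)
  let W : WeierstrassCurve (v.adicCompletionIntegers ℚ) := ⟨0, 0, 0, -1, 0⟩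
  have hΔ : IsUnit W.Δ := by
    have : W.Δ = 2 ^ 6 := by
      simp only [W, WeierstrassCurve.Δ, b₂, b₄, b₆, b₈]
      ring
    rw [this]
    exact h2.pow 6
  have hW : curveE.baseChange (v.adicCompletion ℚ) =
      W.map (algebraMap (v.adicCompletionIntegers ℚ) (v.adicCompletion ℚ)) := by
    ext <;> simp [curveE, W, WeierstrassCurve.baseChange]
  have hpoints : Nat.card {xy : IsLocalRing.ResidueField (v.adicCompletionIntegers ℚ) ×
      IsLocalRing.ResidueField (v.adicCompletionIntegers ℚ) //
        (W.map (IsLocalRing.residue (v.adicCompletionIntegers ℚ))).toAffine.Equation xy.1 xy.2} =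
      Nat.card {xy : ZMod p × ZMod p // xy.2 ^ 2 = xy.1 ^ 3 - xy.1} := by
    refine Nat.card_congr ((e.toEquiv.prodCongr e.toEquiv).subtypeEquiv fun xy ↦ ?_)
    rw [Affine.equation_iff]
    simp only [W, map_a₁, map_a₂, map_a₃, map_a₄, map_a₆, map_zero, map_neg, map_one]
    rw [← e.injective.eq_iff]
    simp [sub_eq_add_neg]
  have hpoly := localPolynomial_of_isUnit_Δ (K := v.adicCompletion ℚ) W h2 h3 hΔ
  rw [hcard, hpoints] at hpoly
  have hc := coeff_invOfUnit_quadratic a p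
  have h1 := LFunction_apply_prime_pow curveE v 1
  have h2 := LFunction_apply_prime_pow curveE v 2
  rw [hvp, hW, localPowerSeries, hpoly] at h1 h2
  exact ⟨by rw [← hc.1, ← h1, pow_one], by rw [← hc.2, ← h2]⟩

end CurveE

/-! ### Ideals of the Gaussian integers of norm `p` and `p²` -/

section GaussianIdeals

open GaussianInt Ideal

/-- The basis `1, i` of the Gaussian integers. -/
noncomputable def gaussianBasis : Module.Basis (Fin 2) ℤ GaussianInt :=
  .ofEquivFun
    { toFun := fun z ↦ ![z.re, z.im]
      invFun := fun v ↦ ⟨v 0, v 1⟩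
      map_add' := fun z w ↦ by ext i; fin_cases i <;> simp
      map_smul' := fun c z ↦ by ext i; fin_cases i <;> simp
      left_inv := fun z ↦ by simp
      right_inv := fun v ↦ by ext i; fin_cases i <;> simp }

lemma algebraNorm_gaussianInt (z : GaussianInt) : Algebra.norm ℤ z = z.norm := by
  rw [Algebra.norm_eq_matrix_det gaussianBasis, Matrix.det_fin_two]
  simp [Algebra.leftMulMatrix_eq_repr_mul, gaussianBasis, Zsqrtd.norm_def]

lemma card_quotient_span_singleton (z : GaussianInt) :
    Nat.card (GaussianInt ⧸ span {z}) = z.norm.natAbs := by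
  have : Module.Free ℤ GaussianInt := .of_basis gaussianBasis
  have : Module.Finite ℤ GaussianInt := .of_basis gaussianBasis
  rw [← algebraNorm_gaussianInt, ← absNorm_span_singleton, absNorm_apply, Submodule.cardQuot_apply]

variable {p : ℕ} [Fact p.Prime] {j : GaussianInt}

omit [Fact p.Prime] in
lemma norm_eq_of_mul_star_eq (hj : j * star j = p) : j.norm = p := by
  have := Zsqrtd.norm_eq_mul_conj j
  rw [hj] at this
  exact_mod_cast this

omit [Fact p.Prime] in
lemma norm_star_eq_of_mul_star_eq (hj : j * star j = p) : (star j).norm = p := by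
  rw [Zsqrtd.norm_conj, norm_eq_of_mul_star_eq hj]

lemma prime_of_mul_star_eq (hj : j * star j = p) : Prime j := by
  rw [← irreducible_iff_prime]
  have hn := norm_eq_of_mul_star_eq hj
  refine ⟨fun h ↦ ?_, fun a b hab ↦ ?_⟩
  · rw [← Zsqrtd.norm_eq_one_iff, hn] at h
    exact (Fact.out : p.Prime).ne_one (by simpa using h)
  · rw [← Zsqrtd.norm_eq_one_iff, ← Zsqrtd.norm_eq_one_iff]
    rw [hab, Zsqrtd.norm_mul] at hn
    have := congrArg Int.natAbs hn
    rw [Int.natAbs_mul, Int.natAbs_natCast] at this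
    exact (Nat.prime_mul_iff.mp (this ▸ (Fact.out : p.Prime))).elim (fun h ↦ .inr h.2)
      (fun h ↦ .inl h.2)

lemma not_dvd_star_of_mul_star_eq (hp2 : p ≠ 2) (hj : j * star j = p) : ¬ j ∣ star j := by
  intro h
  have hp : p.Prime := Fact.out
  have hn := norm_eq_of_mul_star_eq hj
  -- `j` divides the integer `j + star j = 2 re j`, hence `p ∣ 4 (re j)²`
  have h1 : j ∣ ((2 * j.re : ℤ) : GaussianInt) := by
    have : ((2 * j.re : ℤ) : GaussianInt) = j + star j := by
      ext <;> simp; ring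
    rw [this]
    exact dvd_add dvd_rfl h
  obtain ⟨c, hc⟩ := h1
  have h2 := congrArg Zsqrtd.norm hc
  rw [Zsqrtd.norm_mul, Zsqrtd.norm_intCast, hn] at h2
  have hpp : Prime (p : ℤ) := Nat.prime_iff_prime_int.mp hp
  have h3 : (p : ℤ) ∣ 2 * j.re := by
    rcases hpp.dvd_or_dvd (Dvd.intro _ h2.symm) with h | h <;> exact h
  have h4 : (p : ℤ) ∣ j.re := by
    refine (hpp.dvd_or_dvd h3).resolve_left fun h ↦ hp2 ?_
    exact (Nat.prime_dvd_prime_iff_eq hp Nat.prime_two).mp (by exact_mod_cast h)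
  rw [Zsqrtd.norm_def] at hn
  have h5 : (p : ℤ) ∣ j.im := by
    refine hpp.dvd_of_dvd_pow (n := 2) ?_
    have : j.im ^ 2 = p - j.re * j.re := by linear_combination hn
    rw [this]
    exact dvd_sub dvd_rfl (h4.mul_left _)
  obtain ⟨x, hx⟩ := h4
  obtain ⟨y, hy⟩ := h5
  rw [hx, hy] at hn
  have h6 : (p : ℤ) * (x ^ 2 + y ^ 2) = 1 := by
    refine mul_left_cancel₀ hpp.ne_zero ?_
    linear_combination hn
  exact hpp.not_isUnit (IsUnit.of_mul_eq_one _ h6)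

/-- A Gaussian integer whose norm is divisible by `p = j j̄` is divisible by `j` or `j̄`. -/
lemma exists_mul_of_norm_eq (hj : j * star j = p) {z : GaussianInt} {m : ℤ}
    (hz : z.norm = p * m) : ∃ w : GaussianInt, w.norm = m ∧ (z = j * w ∨ z = star j * w) := by
  have hp0 : (p : ℤ) ≠ 0 := by exact_mod_cast (Fact.out : p.Prime).ne_zero
  have hdvd : j ∣ z * star z := by
    rw [← Zsqrtd.norm_eq_mul_conj, hz]
    push_cast
    rw [← hj, mul_assoc]
    exact Dvd.intro _ rfl
  rcases (prime_of_mul_star_eq hj).dvd_or_dvd hdvd with ⟨w, hw⟩ | ⟨w, hw⟩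
  · refine ⟨w, ?_, .inl hw⟩
    rw [hw, Zsqrtd.norm_mul, norm_eq_of_mul_star_eq hj] at hz
    exact mul_left_cancel₀ hp0 hz
  · have hw' : z = star j * star w := by rw [← star_mul', ← hw, star_star]
    refine ⟨star w, ?_, .inr hw'⟩
    rw [hw', Zsqrtd.norm_mul, norm_star_eq_of_mul_star_eq hj] at hz
    exact mul_left_cancel₀ hp0 hz

lemma span_singleton_mul_of_norm_eq_one {z w : GaussianInt} (hw : w.norm = 1) :
    span {z * w} = span {z} := by
  rw [span_singleton_eq_span_singleton]
  exact (associated_mul_unit_right z w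
    ((Zsqrtd.norm_eq_one_iff (d := -1)).mp (by rw [hw]; rfl))).symm

lemma setOf_card_quotient_eq_prime (hj : j * star j = p) :
    {𝔞 : Ideal GaussianInt | Nat.card (GaussianInt ⧸ 𝔞) = p} = {span {j}, span {star j}} := by
  ext 𝔞
  simp only [Set.mem_ofPred_eq, Set.mem_insert_iff, Set.mem_singleton_iff]
  constructor
  · intro h
    obtain ⟨z, rfl⟩ : ∃ z, 𝔞 = span {z} := (IsPrincipalIdealRing.principal 𝔞).principal
    rw [card_quotient_span_singleton] at h
    have hz : z.norm = p * 1 := by rw [← abs_natCast_norm, h, mul_one]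
    obtain ⟨w, hw, rfl | rfl⟩ := exists_mul_of_norm_eq hj hz
    · exact .inl (span_singleton_mul_of_norm_eq_one hw)
    · exact .inr (span_singleton_mul_of_norm_eq_one hw)
  · rintro (rfl | rfl)
    · rw [card_quotient_span_singleton, norm_eq_of_mul_star_eq hj, Int.natAbs_natCast]
    · rw [card_quotient_span_singleton, norm_star_eq_of_mul_star_eq hj, Int.natAbs_natCast]

lemma setOf_card_quotient_eq_prime_sq (hj : j * star j = p) :
    {𝔞 : Ideal GaussianInt | Nat.card (GaussianInt ⧸ 𝔞) = p ^ 2} =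
      {span {j} ^ 2, span {j} * span {star j}, span {star j} ^ 2} := by
  have hn := norm_eq_of_mul_star_eq hj
  have hn' := norm_star_eq_of_mul_star_eq hj
  ext 𝔞
  simp only [Set.mem_ofPred_eq, Set.mem_insert_iff, Set.mem_singleton_iff,
    span_singleton_mul_span_singleton, sq]
  constructor
  · intro h
    obtain ⟨z, rfl⟩ : ∃ z, 𝔞 = span {z} := (IsPrincipalIdealRing.principal 𝔞).principal
    rw [card_quotient_span_singleton] at h
    have hz : z.norm = p * (p * 1) := by rw [← abs_natCast_norm, h]; push_cast; ring
    obtain ⟨w, hw, hzw⟩ := exists_mul_of_norm_eq hj hz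
    obtain ⟨u, hu, hwu⟩ := exists_mul_of_norm_eq hj hw
    rcases hzw with rfl | rfl <;> rcases hwu with rfl | rfl <;>
      rw [← mul_assoc, span_singleton_mul_of_norm_eq_one hu]
    · exact .inl rfl
    · exact .inr (.inl rfl)
    · exact .inr (.inl (by rw [mul_comm]))
    · exact .inr (.inr rfl)
  · rintro (rfl | rfl | rfl) <;>
      simp [card_quotient_span_singleton, Zsqrtd.norm_mul, Int.natAbs_mul, hn]

variable (χ : GaussianHeckeCharacter)

lemma GaussianHeckeCharacter.LFunction_apply {n : ℕ} (hn : n ≠ 0) :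
    χ.LFunction n = ∑ᶠ 𝔞 ∈ {𝔞 : Ideal GaussianInt | Nat.card (GaussianInt ⧸ 𝔞) = n},
      χ.toHom 𝔞 :=
  if_neg hn

lemma GaussianHeckeCharacter.LFunction_apply_prime (hp2 : p ≠ 2) (hj : j * star j = p) :
    χ.LFunction p = χ.toHom (span {j}) + χ.toHom (span {star j}) := by
  rw [χ.LFunction_apply (Fact.out : p.Prime).ne_zero, setOf_card_quotient_eq_prime hj,
    finsum_mem_pair]
  intro h
  refine not_dvd_star_of_mul_star_eq hp2 hj ?_
  rw [← mem_span_singleton, h]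
  exact mem_span_singleton_self _

lemma GaussianHeckeCharacter.LFunction_apply_prime_sq (hp2 : p ≠ 2) (hj : j * star j = p) :
    χ.LFunction (p ^ 2) = χ.toHom (span {j}) ^ 2 +
      χ.toHom (span {j}) * χ.toHom (span {star j}) + χ.toHom (span {star j}) ^ 2 := by
  have hj' : star j * star (star j) = p := by rw [star_star, mul_comm, hj]
  have hnot := not_dvd_star_of_mul_star_eq hp2 hj
  have hnot' : ¬ star j ∣ j := by simpa using not_dvd_star_of_mul_star_eq hp2 hj'
  have hprime := prime_of_mul_star_eq hj
  have hprime' := prime_of_mul_star_eq hj'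
  rw [χ.LFunction_apply (pow_ne_zero 2 (Fact.out : p.Prime).ne_zero),
    setOf_card_quotient_eq_prime_sq hj, finsum_mem_insert, finsum_mem_pair]
  · simp only [map_mul, map_pow]
    ring
  · simp only [span_singleton_pow, span_singleton_mul_span_singleton]
    intro h
    have : j ∣ star j ^ 2 := by
      have h1 : star j ^ 2 ∈ span {j * star j} := by rw [h]; exact mem_span_singleton_self _
      exact (Dvd.intro _ rfl).trans (mem_span_singleton.mp h1)
    exact hnot (hprime.dvd_of_dvd_pow this)
  · simp only [span_singleton_pow, span_singleton_mul_span_singleton, Set.mem_insert_iff,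
      Set.mem_singleton_iff, not_or]
    have key : ¬ star j ∣ j ^ 2 := fun h ↦ hnot' (hprime'.dvd_of_dvd_pow h)
    constructor
    · intro h
      have h1 : j ^ 2 ∈ span {j * star j} := by rw [← h]; exact mem_span_singleton_self _
      exact key ((Dvd.intro_left _ rfl).trans (mem_span_singleton.mp h1))
    · intro h
      have h1 : j ^ 2 ∈ span {star j ^ 2} := by rw [← h]; exact mem_span_singleton_self _
      exact key ((dvd_pow_self _ two_ne_zero).trans (mem_span_singleton.mp h1))
  · simp

/-- A normalized Hecke character with Euler polynomial `1 + (j + j̄) X + p X²` at `p = j j̄` takes the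
value `-j` at the prime `(j)`: the first two coefficients show that this value is `-j` or `-j̄`, and
`j̄` does not lie in `(j)`. -/
lemma GaussianHeckeCharacter.toHom_span_eq_neg (hχ : χ.IsNormalized) (hp2 : p ≠ 2)
    (hj : j * star j = p)
    (h1 : χ.LFunction p = -(toComplex j + toComplex (star j)))
    (h2 : χ.LFunction (p ^ 2) = (toComplex j + toComplex (star j)) ^ 2 - p) :
    χ.toHom (span {j}) = -toComplex j := by
  have hprime := prime_of_mul_star_eq hj
  rw [χ.LFunction_apply_prime hp2 hj] at h1
  rw [χ.LFunction_apply_prime_sq hp2 hj] at h2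
  have hjC : toComplex j * toComplex (star j) = p := by
    rw [← map_mul, hj, map_natCast]
  obtain ⟨z, hz, hzχ⟩ := hχ (span {j})
    ((span_singleton_prime hprime.ne_zero).mpr hprime) (by simpa using hprime.ne_zero)
  have hroot : (χ.toHom (span {j}) + toComplex j) *
      (χ.toHom (span {j}) + toComplex (star j)) = 0 := by
    linear_combination hjC + h2 +
      (toComplex j + toComplex (star j) - χ.toHom (span {star j})) * h1
  rcases mul_eq_zero.mp hroot with h | h
  · exact eq_neg_of_add_eq_zero_left h
  · exfalso
    rw [← hzχ, ← map_add, toComplex_eq_zero] at h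
    refine not_dvd_star_of_mul_star_eq hp2 hj ?_
    rw [← dvd_neg, ← eq_neg_of_add_eq_zero_left h]
    exact mem_span_singleton.mp hz

end GaussianIdeals

/-! ### The Jacobi sum of the quartic character and the Hecke character -/

section JacobiSum

open GaussianInt Ideal

lemma sum_pow_mul_one_sub_pow {F : Type*} [Field F] [Fintype F] {m n : ℕ}
    (h : m + n < Fintype.card F - 1) : ∑ x : F, x ^ m * (1 - x) ^ n = 0 := by
  classical
  let P : Polynomial F := Polynomial.X ^ m * (1 - Polynomial.X) ^ n
  have hdeg : P.natDegree < Fintype.card F - 1 := by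
    refine lt_of_le_of_lt ?_ h
    simp only [P]
    compute_degree
  calc ∑ x : F, x ^ m * (1 - x) ^ n = ∑ x : F, P.eval x := by simp [P]
    _ = ∑ i ∈ Finset.range (Fintype.card F - 1), P.coeff i * ∑ x : F, x ^ i := by
      simp only [Polynomial.eval_eq_sum_range' hdeg, Finset.mul_sum]
      exact Finset.sum_comm
    _ = 0 := Finset.sum_eq_zero fun i hi ↦ by
      rw [FiniteField.sum_pow_lt_card_sub_one F i (Finset.mem_range.mp hi), mul_zero]

variable {p : ℕ} [Fact p.Prime] {𝔭 : Ideal GaussianInt} {ψ : MulChar (ZMod p) ℂ}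

/-- The residue ring at a prime above `p` receives the prime field, and the values of the quartic
character are given there by the `(p - 1) / 4`-th power map. -/
lemma IsQuarticCharacterAt.exists_lift (hψ : IsQuarticCharacterAt p 𝔭 ψ)
    (h𝔭 : 𝔭.IsPrime) (hp𝔭 : (p : GaussianInt) ∈ 𝔭) :
    ∃ (f : ZMod p →+* GaussianInt ⧸ 𝔭) (z : ZMod p → GaussianInt), ∀ x,
      toComplex (z x) = ψ x ∧ Ideal.Quotient.mk 𝔭 (z x) = f (x ^ ((p - 1) / 4)) := by
  have : Nontrivial (GaussianInt ⧸ 𝔭) := Ideal.Quotient.nontrivial_iff.mpr h𝔭.ne_top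
  have hchar : ringChar (GaussianInt ⧸ 𝔭) = p := CharP.ringChar_of_prime_eq_zero Fact.out
    (by simpa using Ideal.Quotient.eq_zero_iff_mem.mpr hp𝔭)
  have : CharP (GaussianInt ⧸ 𝔭) p := ringChar.of_eq hchar
  let f : ZMod p →+* GaussianInt ⧸ 𝔭 := ZMod.castHom dvd_rfl _
  have hz (x : ZMod p) : ∃ z : GaussianInt, toComplex z = ψ x ∧
      Ideal.Quotient.mk 𝔭 z = f (x ^ ((p - 1) / 4)) := by
    obtain ⟨n, rfl⟩ := ZMod.intCast_surjective x
    obtain ⟨z, hz, hmem⟩ := hψ.2 n n (by simp)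
    refine ⟨z, hz, ?_⟩
    rw [Ideal.Quotient.eq.mpr hmem]
    simp
  choose z hz using hz
  exact ⟨f, z, hz⟩

lemma IsQuarticCharacterAt.sq_eq (hψ : IsQuarticCharacterAt p 𝔭 ψ) (hp : p % 4 = 1)
    (h𝔭 : 𝔭.IsPrime) (hp𝔭 : (p : GaussianInt) ∈ 𝔭) : ψ ^ 2 = complexQuadraticChar (ZMod p) := by
  obtain ⟨f, z, hz⟩ := hψ.exists_lift h𝔭 hp𝔭
  have hψ4 : ψ ^ 4 = 1 := hψ.1 ▸ pow_orderOf_eq_one ψ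
  have h2 : ringChar (ZMod p) ≠ 2 := by rw [ZMod.ringChar_zmod_n]; rintro rfl; simp at hp
  have h2𝔭 : (2 : GaussianInt) ∉ 𝔭 := by
    intro h
    refine h𝔭.one_notMem ?_
    have hp' : (p : GaussianInt) = 2 * ((p / 2 : ℕ) : GaussianInt) + 1 := by
      exact_mod_cast (by lia : p = 2 * (p / 2) + 1)
    rw [show (1 : GaussianInt) = p - 2 * ((p / 2 : ℕ) : GaussianInt) by rw [hp']; ring]
    exact 𝔭.sub_mem hp𝔭 (𝔭.mul_mem_right _ h)
  ext x
  have hx0 : (x : ZMod p) ≠ 0 := x.ne_zero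
  rw [MulChar.pow_apply' _ two_ne_zero, complexQuadraticChar_apply, ← (hz x).1, ← map_pow,
    ← map_intCast toComplex, toComplex_inj]
  have hcong : z x ^ 2 - ((quadraticChar (ZMod p) x : ℤ) : GaussianInt) ∈ 𝔭 := by
    rw [← Ideal.Quotient.eq, map_pow, (hz x).2, ← map_pow, ← pow_mul, map_intCast,
      show (p - 1) / 4 * 2 = Fintype.card (ZMod p) / 2 by rw [ZMod.card]; lia,
      ← quadraticChar_eq_pow_of_char_ne_two' h2, map_intCast]
  have hsq : (z x ^ 2) ^ 2 = 1 := by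
    rw [← pow_mul, ← toComplex_inj, map_pow, (hz x).1, map_one]
    exact MulChar.apply_pow_four_eq_one hψ4 hx0
  rcases sq_eq_sq_iff_eq_or_eq_neg.mp (hsq.trans (one_pow 2).symm) with h | h <;>
    rcases quadraticChar_dichotomy hx0 with h' | h' <;> rw [h, h'] at hcong ⊢
  · simp
  · exact absurd (by convert hcong using 1; norm_num) h2𝔭
  · exact absurd (by convert 𝔭.neg_mem hcong using 1; norm_num) h2𝔭
  · simp

/-- The Jacobi sum `J(ψ², ψ)` is a Gaussian integer `j` in `𝔭` with `j j̄ = p`: modulo `𝔭` it is a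
power sum of degree less than `p - 1`. -/
lemma IsQuarticCharacterAt.exists_jacobiSum_eq (hψ : IsQuarticCharacterAt p 𝔭 ψ) (hp : p % 4 = 1)
    (h𝔭 : 𝔭.IsPrime) (hp𝔭 : (p : GaussianInt) ∈ 𝔭) :
    ∃ j : GaussianInt, toComplex j = jacobiSum (complexQuadraticChar (ZMod p)) ψ ∧
      toComplex (star j) = jacobiSum (complexQuadraticChar (ZMod p)) ψ⁻¹ ∧
      j * star j = p ∧ 𝔭 = span {j} := by
  obtain ⟨f, z, hz⟩ := hψ.exists_lift h𝔭 hp𝔭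
  have hp' : p.Prime := Fact.out
  have hsq := hψ.sq_eq hp h𝔭 hp𝔭
  have hψ4 : ψ ^ 4 = 1 := hψ.1 ▸ pow_orderOf_eq_one ψ
  have hψ1 : ψ ≠ 1 := by
    rintro rfl
    simpa using hψ.1
  have hψ2 : ψ ^ 2 ≠ 1 := pow_ne_one_of_lt_orderOf two_ne_zero (by rw [hψ.1]; norm_num)
  have hψ3 : ψ ^ 2 * ψ ≠ 1 := by
    rw [← pow_succ]
    exact pow_ne_one_of_lt_orderOf three_ne_zero (by rw [hψ.1]; norm_num)
  have hφinv : (complexQuadraticChar (ZMod p))⁻¹ = complexQuadraticChar (ZMod p) := by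
    rw [← hsq, inv_eq_iff_mul_eq_one, ← pow_add, hψ4]
  let j : GaussianInt := ∑ x, z x ^ 2 * z (1 - x)
  have hj : toComplex j = jacobiSum (complexQuadraticChar (ZMod p)) ψ := by
    rw [← hsq, jacobiSum, map_sum]
    refine Finset.sum_congr rfl fun x _ ↦ ?_
    rw [map_mul, map_pow, (hz x).1, (hz (1 - x)).1, MulChar.pow_apply' _ two_ne_zero]
  have hj' : toComplex (star j) = jacobiSum (complexQuadraticChar (ZMod p)) ψ⁻¹ := by
    rw [toComplex_star, hj, jacobiSum, jacobiSum, map_sum]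
    refine Finset.sum_congr rfl fun x _ ↦ ?_
    rw [map_mul, ← RCLike.star_def, MulChar.star_apply', MulChar.star_apply', hφinv]
  have hjj : j * star j = p := by
    rw [← toComplex_inj, map_mul, hj, hj', map_natCast]
    nth_rewrite 2 [← hφinv]
    rw [jacobiSum_mul_jacobiSum_inv _ (hsq ▸ hψ2) hψ1 (hsq ▸ hψ3), ZMod.card]
    rw [ZMod.ringChar_zmod_n, ringChar.eq_zero]
    exact hp'.ne_zero.symm
  have hmem : j ∈ 𝔭 := by
    rw [← Ideal.Quotient.eq_zero_iff_mem, map_sum]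
    have hmod (x : ZMod p) : Ideal.Quotient.mk 𝔭 (z x ^ 2 * z (1 - x)) =
        f (x ^ ((p - 1) / 4 * 2) * (1 - x) ^ ((p - 1) / 4)) := by
      rw [map_mul, map_pow, (hz x).2, (hz (1 - x)).2, map_mul, pow_mul, map_pow f _ 2]
    simp only [hmod]
    rw [← map_sum, sum_pow_mul_one_sub_pow, map_zero]
    rw [ZMod.card]
    have := hp'.two_le
    lia
  have hprime := prime_of_mul_star_eq hjj
  have hmax : (span {j}).IsMaximal := PrincipalIdealRing.isMaximal_of_irreducible hprime.irreducible
  refine ⟨j, hj, hj', hjj, (hmax.eq_of_le h𝔭.ne_top ?_).symm⟩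
  rwa [span_singleton_le_iff_mem]

/-- Counting the points of `y² = x³ - x` by the quadratic character. -/
lemma card_sq_eq_cube_sub_self {F : Type*} [Field F] [Fintype F] (h2 : ringChar F ≠ 2) :
    (Nat.card {xy : F × F // xy.2 ^ 2 = xy.1 ^ 3 - xy.1} : ℂ) =
      Fintype.card F + ∑ x, complexQuadraticChar F (x ^ 3 - x) := by
  classical
  let e : {xy : F × F // xy.2 ^ 2 = xy.1 ^ 3 - xy.1} ≃
      (x : F) × {y : F // y ^ 2 = x ^ 3 - x} :=
    { toFun := fun xy ↦ ⟨xy.1.1, xy.1.2, xy.2⟩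
      invFun := fun s ↦ ⟨(s.1, s.2.1), s.2.2⟩
      left_inv := fun _ ↦ rfl
      right_inv := fun _ ↦ rfl }
  rw [Nat.card_congr e, Nat.card_sigma]
  push_cast
  have hfib (x : F) : (Nat.card {y : F // y ^ 2 = x ^ 3 - x} : ℂ) =
      complexQuadraticChar F (x ^ 3 - x) + 1 := by
    have := congrArg (Int.cast (R := ℂ)) (quadraticChar_card_sqrts h2 (x ^ 3 - x))
    push_cast at this
    rw [complexQuadraticChar_apply, ← this, Set.toFinset_card, Nat.card_eq_fintype_card]
    rfl
  simp only [hfib, Finset.sum_add_distrib]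
  simp [add_comm]

/-- The value of the Hecke character of `y² = x³ - x` at `𝔭` is a Jacobi sum. -/
lemma GaussianHeckeCharacter.toHom_eq_neg_jacobiSum (χ : GaussianHeckeCharacter)
    (hχE : χ.IsAssociatedTo curveE) (hχ : χ.IsNormalized) (hp : p % 4 = 1)
    (h𝔭 : 𝔭.IsPrime) (hp𝔭 : (p : GaussianInt) ∈ 𝔭) (hψ : IsQuarticCharacterAt p 𝔭 ψ) :
    χ.toHom 𝔭 = -jacobiSum (complexQuadraticChar (ZMod p)) ψ := by
  obtain ⟨j, hj, hj', hjj, h𝔭j⟩ := hψ.exists_jacobiSum_eq hp h𝔭 hp𝔭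
  have hp2 : p ≠ 2 := by rintro rfl; simp at hp
  have hp3 : p ≠ 3 := by rintro rfl; simp at hp
  have h2 : ringChar (ZMod p) ≠ 2 := by rwa [ZMod.ringChar_zmod_n]
  have hψ4 : ψ ^ 4 = 1 := hψ.1 ▸ pow_orderOf_eq_one ψ
  obtain ⟨hL1, hL2⟩ := curveE_LFunction_apply p hp2 hp3
  set a : ℤ := p - Nat.card {xy : ZMod p × ZMod p // xy.2 ^ 2 = xy.1 ^ 3 - xy.1} with ha
  have haC : (a : ℂ) = -(toComplex j + toComplex (star j)) := by
    rw [ha]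
    push_cast
    rw [card_sq_eq_cube_sub_self h2, ZMod.card,
      sum_complexQuadraticChar_cube_sub_self h2 (hψ.sq_eq hp h𝔭 hp𝔭) hψ4, hj, hj']
    ring
  have hL (n : ℕ) : χ.LFunction n = (curveE.LFunction n : ℂ) := by
    rw [← hχE]
    simp
  rw [h𝔭j, ← hj]
  refine χ.toHom_span_eq_neg hχ hp2 hjj ?_ ?_
  · rw [hL, hL1, haC]
  · rw [hL, hL2]
    push_cast
    rw [haC, neg_sq]

end JacobiSum

theorem theorem2p1
    (χ : GaussianHeckeCharacter) (hχE : χ.IsAssociatedTo curveE) (hχ : χ.IsNormalized)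
    (p : ℕ) [Fact p.Prime] (hp : p % 4 = 1)
    (𝔭 : Ideal GaussianInt) (h𝔭 : 𝔭.IsPrime) (hp𝔭 : (p : GaussianInt) ∈ 𝔭)
    (ψ : MulChar (ZMod p) ℂ) (hψ : IsQuarticCharacterAt p 𝔭 ψ)
    (a : ZMod p) (ha0 : a ≠ 0) (ha1 : a ≠ 1) :
    ((¬ IsSquare a ∨ ¬ IsSquare (1 - a)) → hypergeom2F1 ψ⁻¹ ψ (quadChar p) a = 0) ∧
    (∀ b : ZMod p, a = b ^ 2 → IsSquare (1 - a) →
      hypergeom2F1 ψ⁻¹ ψ (quadChar p) a =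
        -(2 / (p : ℂ)) * quadChar p (1 + b) * χ.toHom 𝔭) := by
  have hsq := hψ.sq_eq hp h𝔭 hp𝔭
  have hψ4 : ψ ^ 4 = 1 := hψ.1 ▸ pow_orderOf_eq_one ψ
  have h2 : ringChar (ZMod p) ≠ 2 := by rw [ZMod.ringChar_zmod_n]; rintro rfl; simp at hp
  have hφneg : complexQuadraticChar (ZMod p) (-1) = 1 :=
    complexQuadraticChar_of_isSquare (by simp) (isSquare_neg_one_of_sq_eq hsq)
  rw [quadChar_eq_complexQuadraticChar, hypergeom2F1_eq_legendreSum hsq hφneg ha0, ZMod.card]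
  refine ⟨fun h ↦ by rw [legendreSum_eq_zero hsq hψ4 ha0 ha1 h, mul_zero], ?_⟩
  rintro b rfl hsquare
  have hb : b ≠ 0 := by rintro rfl; simp at ha0
  have h1a : 1 - b ^ 2 ≠ 0 := sub_ne_zero.mpr ha1.symm
  have hprod : (1 + b) * (1 - b) = 1 - b ^ 2 := by ring
  have h1b : 1 + b ≠ 0 := left_ne_zero_of_mul (hprod ▸ h1a)
  -- `1 - a = (1 + b)(1 - b)` is a square, so the two terms of `legendreSum_sq` agree
  have hφ : complexQuadraticChar (ZMod p) (1 - b) = complexQuadraticChar (ZMod p) (1 + b) := by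
    have h3 := complexQuadraticChar_of_isSquare h1a hsquare
    have h4 := complexQuadraticChar_sq h1b
    rw [← hprod, map_mul] at h3
    rw [map_pow] at h4
    linear_combination complexQuadraticChar (ZMod p) (1 + b) * h3 -
      complexQuadraticChar (ZMod p) (1 - b) * h4
  rw [legendreSum_sq h2 hsq hb h1a, hφ, χ.toHom_eq_neg_jacobiSum hχE hχ hp h𝔭 hp𝔭 hψ]
  linear_combination 2 / (p : ℂ) * complexQuadraticChar (ZMod p) (1 + b) *
    jacobiSum (complexQuadraticChar (ZMod p)) ψ * MulChar.map_neg_one_sq ψ
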